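/- Let $s\in\mathbb N_0$ and $\Pi=\mathbb C[x_1,\dots,x_s]$. For $\alpha\in\mathbb Z^s$ let $\tau^\alpha$ be the shift $(\tau^\alpha u)(x)=u(x+\alpha)$ on sequences $u:\mathbb Z^s\to\mathbb C$; for $q=\sum_\alpha q_\alpha x^\alpha\in\Pi$ put $q(\tau)=\sum_\alpha q_\alpha\tau^\alpha$, and for $Q\subset\Pi$ put $\ker Q(\tau)=\{u:\ q(\tau)u=0 \text{ for all } q\in Q\}$. An exponential polynomial sequence is a sequence of the form $$f(\alpha)=\sum_{\omega\in\Omega}f_\omega(\alpha)\,e^{\omega^T\alpha},\qquad \alpha\in\mathbb Z^s,$$ with $\Omega\subset\mathbb C^s$ finite and $f_\omega\in\Pi$; the total multiplicity of this representation is $\sum_{\omega\in\Omega}\dim\operatorname{span}\{f_\omega(\cdot+\alpha):\alpha\in\mathbb N_0^s\}$. (1) For every exponential polynomial sequence $f$ there is a finite set $Q\subset\Pi$ such that $$\operatorname{span}\{\tau^\alpha f:\ \alpha\in\mathbb Z^s\}=\ker Q(\tau),$$ and such that $Q$ generates the Prony ideal $\{p\in\Pi:\ p(\tau)f=0\}$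 of $f$. (2) Such a $Q$ can be constructed from finitely many values of $f$, given an upper bound for the total multiplicity: for every $N\in\mathbb N_0$ there are a finite set $\Lambda\subset\mathbb Z^s$ and a finite algebraic procedure, both depending only on $s$ and $N$, such that for every exponential polynomial sequence $f$ having a representation of total multiplicity at most $N$, the procedure, run on the samples $(f(\lambda))_{\lambda\in\Lambda}$, outputs a finite set $Q\subset\Pi$ with the properties in (1). Here a finite algebraic procedure is a finite decision tree which at each inner node tests whether some polynomial with integer coefficients in the samples is zero, and at each leaf outputs finitely many elements of $\Pi$ whose coefficients are polynomials with integer coefficients in the samples. -/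

import Mathlib

noncomputable section

/-- The shift `τ^α` on sequences `ℤ^s → ℂ`: `(τ^α u)(x) = u (x + α)`, for `α ∈ ℤ^s`. -/
def shiftOp {s : ℕ} (α : Fin s → ℤ) : ((Fin s → ℤ) → ℂ) →ₗ[ℂ] ((Fin s → ℤ) → ℂ) :=
  LinearMap.funLeft ℂ ℂ (fun x => x + α)

/-- The difference operator `q(τ) = ∑_α q_α τ^α` of a polynomial `q = ∑_α q_α x^α`. -/
def diffOp {s : ℕ} (q : MvPolynomial (Fin s) ℂ) :
    ((Fin s → ℤ) → ℂ) →ₗ[ℂ] ((Fin s → ℤ) → ℂ) :=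
  ∑ α ∈ q.support, q.coeff α • shiftOp (fun j => (α j : ℤ))

/-- `ker Q(τ)`, the common kernel of the operators `q(τ)`, `q ∈ Q`. -/
def diffKer {s : ℕ} (Q : Set (MvPolynomial (Fin s) ℂ)) : Submodule ℂ ((Fin s → ℤ) → ℂ) :=
  ⨅ q ∈ Q, LinearMap.ker (diffOp q)

/-- `span {τ^α f : α ∈ ℤ^s}`. -/
def translateSpan {s : ℕ} (f : (Fin s → ℤ) → ℂ) : Submodule ℂ ((Fin s → ℤ) → ℂ) :=
  Submodule.span ℂ (Set.range fun α : Fin s → ℤ => shiftOp α f)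

/-- The exponential polynomial sequence `α ↦ ∑_{ω ∈ Ω} f_ω(α) e^{ω^T α}` with frequency set `Ω`
and coefficient polynomials `f_ω = c ω` (the values of `c` off `Ω` play no role). -/
def expPolySeq {s : ℕ} (Ω : Finset (Fin s → ℂ)) (c : (Fin s → ℂ) → MvPolynomial (Fin s) ℂ) :
    (Fin s → ℤ) → ℂ :=
  fun α => ∑ ω ∈ Ω, MvPolynomial.eval (fun j => (α j : ℂ)) (c ω) *
    Complex.exp (∑ j, ω j * (α j : ℂ))

/-- The translated polynomial `p(· + α)`, for `α ∈ ℕ^s`. -/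
def polyTranslate {s : ℕ} (α : Fin s → ℕ) (p : MvPolynomial (Fin s) ℂ) :
    MvPolynomial (Fin s) ℂ :=
  MvPolynomial.bind₁ (fun j => MvPolynomial.X j + MvPolynomial.C (α j : ℂ)) p

/-- The principal shift invariant space `S(p) = span {p(· + α) : α ∈ ℕ^s}`. -/
def polyShiftSpan {s : ℕ} (p : MvPolynomial (Fin s) ℂ) : Submodule ℂ (MvPolynomial (Fin s) ℂ) :=
  Submodule.span ℂ (Set.range fun α : Fin s → ℕ => polyTranslate α p)

/-- `S(p)` is finite dimensional, so that `Module.finrank` below is its dimension. -/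
theorem polyShiftSpan_finite {s : ℕ} (p : MvPolynomial (Fin s) ℂ) :
    Module.Finite ℂ (polyShiftSpan p) := by
  have hle : polyShiftSpan p ≤ MvPolynomial.restrictTotalDegree (Fin s) ℂ p.totalDegree := by
    refine Submodule.span_le.2 ?_
    rintro _ ⟨α, rfl⟩
    change polyTranslate α p ∈ MvPolynomial.restrictTotalDegree (Fin s) ℂ p.totalDegree
    rw [MvPolynomial.mem_restrictTotalDegree, polyTranslate, MvPolynomial.bind₁,
      MvPolynomial.aeval_def, MvPolynomial.eval₂_eq]
    refine MvPolynomial.totalDegree_finsetSum_le fun d hd => ?_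
    refine (MvPolynomial.totalDegree_mul _ _).trans ?_
    rw [MvPolynomial.algebraMap_eq, MvPolynomial.totalDegree_C, zero_add]
    refine (MvPolynomial.totalDegree_finsetProd _ _).trans ?_
    refine le_trans ?_ (MvPolynomial.le_totalDegree hd)
    refine Finset.sum_le_sum fun j _ => (MvPolynomial.totalDegree_pow _ _).trans ?_
    refine (Nat.mul_le_mul_left _ ((MvPolynomial.totalDegree_add _ _).trans ?_)).trans
      (mul_one (d j)).le
    rw [MvPolynomial.totalDegree_X, MvPolynomial.totalDegree_C, max_eq_left zero_le_one]
  exact Module.Finite.of_injective (Submodule.inclusion hle) (Submodule.inclusion_injective hle)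

/-- The total multiplicity `∑_{ω ∈ Ω} dim S(f_ω)`. -/
def totalMultiplicity {s : ℕ} (Ω : Finset (Fin s → ℂ))
    (c : (Fin s → ℂ) → MvPolynomial (Fin s) ℂ) : ℕ :=
  ∑ ω ∈ Ω, Module.finrank ℂ (polyShiftSpan (c ω))

/-- A terminating algebraic procedure on input values `y_i`, `i ∈ ι`: it performs finitely many
ring operations on the input, may branch on whether a computed number (an integer polynomial in
the input) is zero, and finally outputs a finite set of polynomials in `s` variables whose
coefficients are computed numbers. -/
inductive AlgProc (s : ℕ) (ι : Type) : Type where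
  | output (Q : Finset (MvPolynomial (Fin s) (MvPolynomial ι ℤ))) : AlgProc s ι
  | test (g : MvPolynomial ι ℤ) (ifZero ifNonzero : AlgProc s ι) : AlgProc s ι

open Classical in
/-- The output of a procedure on the input `y`. -/
def AlgProc.run {s : ℕ} {ι : Type} (y : ι → ℂ) : AlgProc s ι → Finset (MvPolynomial (Fin s) ℂ)
  | .output Q => Q.image (MvPolynomial.map (MvPolynomial.eval₂Hom (Int.castRingHom ℂ) y))
  | .test g T₀ T₁ =>
      if MvPolynomial.eval₂Hom (Int.castRingHom ℂ) y g = 0 then T₀.run y else T₁.run y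

/-- The finite set `Q` is a Prony system of `f`: its difference operators have exactly the span of
the translates of `f` as common kernel, and it generates the ideal of all polynomials `p` with
`p(τ) f = 0`. -/
def IsPronySystem {s : ℕ} (f : (Fin s → ℤ) → ℂ) (Q : Finset (MvPolynomial (Fin s) ℂ)) : Prop :=
  translateSpan f = diffKer (Q : Set (MvPolynomial (Fin s) ℂ)) ∧
  (Ideal.span (Q : Set (MvPolynomial (Fin s) ℂ)) : Set (MvPolynomial (Fin s) ℂ)) =
    {p | diffOp p f = 0}

end

/-! Let I be the Prony ideal of f. The space V = {p(τ)f : p ∈ Π} ≅ Π/I has dimension at most the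
total multiplicity. Shifts are injective on V, hence invertible there, so V contains all translates
of f and monomials are units modulo I. Therefore u ∈ ker I(τ) is determined by the functional p ↦
(p(τ)u)(0) on Π/I, and dim ker I(τ) ≤ dim Π/I = dim V forces V = ker I(τ)
(`translateSpan_eq_diffKer_pronyIdeal`). Any finite generating set of I is thus a Prony system.

If dim Π/I ≤ N, Cayley–Hamilton gives a monic relation of degree N in each variable. Hence I is
generated by its elements of degree at most N in each variable (`span_inf_restrictDegree_eq`), and p
∈ I as soon as p(τ)f vanishes on {0,…,N}^s (`mem_pronyIdeal_of_forall_box`). These elements form the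
kernel of a Hankel matrix of samples on {0,…,2N}^s, which division-free elimination with zero tests
computes (`exists_algProc_span_run`). -/

noncomputable section

/-! ### Shifts and the action of Π on sequences -/

theorem shiftOp_apply {s : ℕ} (α : Fin s → ℤ) (u : (Fin s → ℤ) → ℂ) (x : Fin s → ℤ) :
    shiftOp α u x = u (x + α) := rfl

theorem shiftOp_shiftOp {s : ℕ} (α β : Fin s → ℤ) (u : (Fin s → ℤ) → ℂ) :
    shiftOp α (shiftOp β u) = shiftOp (α + β) u := by
  ext x
  simp only [shiftOp_apply, add_assoc]

theorem shiftOp_zero {s : ℕ} (u : (Fin s → ℤ) → ℂ) : shiftOp 0 u = u := by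
  ext x
  simp [shiftOp_apply]

theorem shiftOp_injective {s : ℕ} (α : Fin s → ℤ) :
    Function.Injective (shiftOp α : ((Fin s → ℤ) → ℂ) →ₗ[ℂ] _) := fun u v h => by
  have h' := congrArg (shiftOp (-α)) h
  simpa [shiftOp_shiftOp, shiftOp_zero] using h'

/-- The multi-index `α ∈ ℕ^s` as an element of `ℤ^s`. -/
def intIndex {s : ℕ} (α : Fin s →₀ ℕ) : Fin s → ℤ := fun j => (α j : ℤ)

theorem intIndex_zero {s : ℕ} : intIndex (0 : Fin s →₀ ℕ) = 0 := by
  ext j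
  simp [intIndex]

theorem intIndex_add {s : ℕ} (α β : Fin s →₀ ℕ) :
    intIndex (α + β) = intIndex α + intIndex β := by
  ext j
  simp [intIndex]

/-- Every `α ∈ ℤ^s` is a difference of two elements of `ℕ^s`. -/
theorem exists_add_intIndex_eq {s : ℕ} (α : Fin s → ℤ) :
    ∃ β γ : Fin s →₀ ℕ, α + intIndex γ = intIndex β := by
  refine ⟨Finsupp.equivFunOnFinite.symm fun j => (α j).toNat,
    Finsupp.equivFunOnFinite.symm fun j => (-α j).toNat, ?_⟩
  ext j
  simp only [intIndex, Pi.add_apply, Finsupp.equivFunOnFinite_symm_apply_apply]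
  omega

/-- `q ↦ q(τ)` as a homomorphism of algebras. -/
def diffHom (s : ℕ) :
    MvPolynomial (Fin s) ℂ →ₐ[ℂ] Module.End ℂ ((Fin s → ℤ) → ℂ) :=
  AddMonoidAlgebra.lift ℂ _ _
    { toFun := fun α => shiftOp (intIndex (Multiplicative.toAdd α))
      map_one' := by
        ext1 u
        rw [toAdd_one, intIndex_zero, shiftOp_zero]
        rfl
      map_mul' := fun α β => by
        ext1 u
        rw [toAdd_mul, intIndex_add, ← shiftOp_shiftOp]
        rfl }

theorem diffOp_eq_diffHom {s : ℕ} (q : MvPolynomial (Fin s) ℂ) : diffOp q = diffHom s q := by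
  rw [diffHom, AddMonoidAlgebra.lift_apply]
  rfl

theorem diffOp_mul {s : ℕ} (p q : MvPolynomial (Fin s) ℂ) (u : (Fin s → ℤ) → ℂ) :
    diffOp (p * q) u = diffOp p (diffOp q u) := by
  simp only [diffOp_eq_diffHom, map_mul, Module.End.mul_apply]

theorem diffOp_monomial {s : ℕ} (α : Fin s →₀ ℕ) (c : ℂ) (u : (Fin s → ℤ) → ℂ) :
    diffOp (MvPolynomial.monomial α c) u = c • shiftOp (intIndex α) u := by
  rw [diffOp_eq_diffHom, diffHom]
  exact LinearMap.congr_fun (AddMonoidAlgebra.lift_single _ α c) u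

theorem diffOp_one {s : ℕ} (u : (Fin s → ℤ) → ℂ) : diffOp 1 u = u := by
  rw [diffOp_eq_diffHom, map_one, Module.End.one_apply]

theorem diffOp_apply {s : ℕ} (q : MvPolynomial (Fin s) ℂ) (u : (Fin s → ℤ) → ℂ)
    (x : Fin s → ℤ) : diffOp q u x = ∑ α ∈ q.support, q.coeff α * u (x + intIndex α) := by
  simp only [diffOp, LinearMap.sum_apply, Finset.sum_apply, LinearMap.smul_apply, Pi.smul_apply,
    smul_eq_mul, shiftOp_apply]
  rfl

theorem diffOp_shiftOp {s : ℕ} (q : MvPolynomial (Fin s) ℂ) (α : Fin s → ℤ)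
    (u : (Fin s → ℤ) → ℂ) : diffOp q (shiftOp α u) = shiftOp α (diffOp q u) := by
  ext x
  simp only [shiftOp_apply, diffOp_apply, add_right_comm]

/-- The linear map `q ↦ q(τ) u`. -/
def diffEval {s : ℕ} (u : (Fin s → ℤ) → ℂ) :
    MvPolynomial (Fin s) ℂ →ₗ[ℂ] ((Fin s → ℤ) → ℂ) :=
  (LinearMap.applyₗ u).comp (diffHom s).toLinearMap

theorem diffEval_apply {s : ℕ} (u : (Fin s → ℤ) → ℂ) (q : MvPolynomial (Fin s) ℂ) :
    diffEval u q = diffOp q u := by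
  rw [diffOp_eq_diffHom]
  rfl

/-! ### The Prony ideal and its kernel -/

/-- The Prony ideal `{p | p(τ) f = 0}` of `f`. -/
def pronyIdeal {s : ℕ} (f : (Fin s → ℤ) → ℂ) : Ideal (MvPolynomial (Fin s) ℂ) where
  carrier := {p | diffOp p f = 0}
  add_mem' := fun {p q} hp hq => by
    simp only [Set.mem_ofPred_eq, ← diffEval_apply, map_add] at *
    rw [hp, hq, add_zero]
  zero_mem' := by simp only [Set.mem_ofPred_eq, ← diffEval_apply, map_zero]
  smul_mem' := fun p q hq => by
    simp only [Set.mem_ofPred_eq, smul_eq_mul, diffOp_mul] at *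
    rw [hq, map_zero]

theorem mem_pronyIdeal {s : ℕ} {f : (Fin s → ℤ) → ℂ} {p : MvPolynomial (Fin s) ℂ} :
    p ∈ pronyIdeal f ↔ diffOp p f = 0 := Iff.rfl

theorem mem_diffKer {s : ℕ} {Q : Set (MvPolynomial (Fin s) ℂ)} {u : (Fin s → ℤ) → ℂ} :
    u ∈ diffKer Q ↔ ∀ q ∈ Q, diffOp q u = 0 := by
  simp [diffKer, Submodule.mem_iInf]

theorem diffKer_span {s : ℕ} (Q : Set (MvPolynomial (Fin s) ℂ)) :
    diffKer (Ideal.span Q : Set (MvPolynomial (Fin s) ℂ)) = diffKer Q := by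
  refine le_antisymm (fun u hu => mem_diffKer.2 fun q hq =>
    mem_diffKer.1 hu q (Ideal.subset_span hq)) fun u hu => mem_diffKer.2 fun q hq => ?_
  have hle : Ideal.span Q ≤ pronyIdeal u := Ideal.span_le.2 fun p hp => mem_diffKer.1 hu p hp
  exact hle hq

theorem self_mem_diffKer_pronyIdeal {s : ℕ} (f : (Fin s → ℤ) → ℂ) :
    f ∈ diffKer (pronyIdeal f : Set (MvPolynomial (Fin s) ℂ)) :=
  mem_diffKer.2 fun _ hp => hp

/-- The quotient by the Prony ideal is the space `{p(τ) f : p ∈ Π}`. -/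
def quotientPronyEquiv {s : ℕ} (f : (Fin s → ℤ) → ℂ) :
    (MvPolynomial (Fin s) ℂ ⧸ pronyIdeal f) ≃ₗ[ℂ] LinearMap.range (diffEval f) :=
  (Submodule.Quotient.restrictScalarsEquiv ℂ (pronyIdeal f)).symm.trans
    ((Submodule.quotEquivOfEq ((pronyIdeal f).restrictScalars ℂ) (LinearMap.ker (diffEval f))
      (by
        ext p
        rw [LinearMap.mem_ker, diffEval_apply]
        rfl)).trans
      (diffEval f).quotKerEquivRange)

theorem mem_range_diffEval {s : ℕ} {f g : (Fin s → ℤ) → ℂ} :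
    g ∈ LinearMap.range (diffEval f) ↔ ∃ q, diffOp q f = g := by
  simp only [LinearMap.mem_range, diffEval_apply]

/-! ### Duality between Π modulo the Prony ideal and the kernel -/

section FiniteDimensional

variable {s : ℕ} {f : (Fin s → ℤ) → ℂ} [FiniteDimensional ℂ (LinearMap.range (diffEval f))]

/-- Monomials are invertible modulo the Prony ideal. -/
theorem exists_inverse_monomial (γ : Fin s →₀ ℕ) :
    ∃ q, q * MvPolynomial.monomial γ 1 - 1 ∈ pronyIdeal f := by
  let V := LinearMap.range (diffEval f)
  have hV : ∀ g ∈ V, shiftOp (intIndex γ) g ∈ V := fun g hg => by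
    obtain ⟨q, rfl⟩ := mem_range_diffEval.1 hg
    refine mem_range_diffEval.2 ⟨MvPolynomial.monomial γ 1 * q, ?_⟩
    rw [diffOp_mul, diffOp_monomial, one_smul]
  -- An injective endomorphism of a finite-dimensional space is onto, so f = τ^γ g for some g in V.
  have hinj : Function.Injective ((shiftOp (intIndex γ)).restrict hV) := fun u v h =>
    Subtype.ext (shiftOp_injective _ (congrArg Subtype.val h))
  obtain ⟨⟨g, hg⟩, hgf⟩ := LinearMap.surjective_of_injective hinj
    ⟨f, mem_range_diffEval.2 ⟨1, diffOp_one f⟩⟩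
  obtain ⟨q, rfl⟩ := mem_range_diffEval.1 hg
  refine ⟨q, ?_⟩
  have h : shiftOp (intIndex γ) (diffOp q f) = f := congrArg Subtype.val hgf
  rw [mem_pronyIdeal, ← diffEval_apply, map_sub, diffEval_apply, diffEval_apply, diffOp_mul,
    diffOp_monomial, one_smul, diffOp_shiftOp, h, diffOp_one, sub_self]

/-- The inverse of a monomial modulo the Prony ideal inverts the shift on the whole kernel, not only
on translates of f. -/
theorem exists_diffOp_shiftOp_eq (γ : Fin s →₀ ℕ) :
    ∃ q, ∀ u ∈ diffKer (pronyIdeal f : Set (MvPolynomial (Fin s) ℂ)),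
      diffOp q (shiftOp (intIndex γ) u) = u := by
  obtain ⟨q, hq⟩ := exists_inverse_monomial (f := f) γ
  refine ⟨q, fun u hu => ?_⟩
  have h := mem_diffKer.1 hu _ hq
  rwa [← diffEval_apply, map_sub, diffEval_apply, diffEval_apply, diffOp_mul,
    diffOp_monomial, one_smul, diffOp_one, sub_eq_zero] at h

/-- Negative shifts of f add nothing, since q(τ) acts on f as τ^(-γ) for a suitable q. -/
theorem translateSpan_eq_range : translateSpan f = LinearMap.range (diffEval f) := by
  refine le_antisymm (Submodule.span_le.2 ?_) ?_
  · rintro _ ⟨α, rfl⟩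
    obtain ⟨β, γ, h⟩ := exists_add_intIndex_eq α
    obtain ⟨q, hq⟩ := exists_diffOp_shiftOp_eq (f := f) γ
    refine mem_range_diffEval.2 ⟨q * MvPolynomial.monomial β 1, ?_⟩
    have h' := hq f (self_mem_diffKer_pronyIdeal f)
    rw [diffOp_mul, diffOp_monomial, one_smul, ← h, ← shiftOp_shiftOp, diffOp_shiftOp, h']
  · intro g hg
    obtain ⟨q, rfl⟩ := mem_range_diffEval.1 hg
    rw [diffOp, LinearMap.sum_apply]
    exact Submodule.sum_mem _ fun α _ =>
      Submodule.smul_mem _ _ (Submodule.subset_span ⟨_, rfl⟩)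

/-- Writing u = q(τ)τ^γ u with x + γ ∈ ℕ^s expresses u(x) through values of u on ℕ^s. -/
theorem eq_zero_of_mem_diffKer_of_intIndex {u : (Fin s → ℤ) → ℂ}
    (hu : u ∈ diffKer (pronyIdeal f : Set (MvPolynomial (Fin s) ℂ)))
    (h0 : ∀ α, u (intIndex α) = 0) : u = 0 := by
  ext x
  obtain ⟨β, γ, h⟩ := exists_add_intIndex_eq x
  obtain ⟨q, hq⟩ := exists_diffOp_shiftOp_eq (f := f) γ
  rw [← hq u hu, diffOp_apply, Pi.zero_apply]
  refine Finset.sum_eq_zero fun α _ => ?_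
  rw [shiftOp_apply, add_right_comm, h, ← intIndex_add, h0, mul_zero]

theorem eq_zero_of_mem_diffKer_of_diffOp {u : (Fin s → ℤ) → ℂ}
    (hu : u ∈ diffKer (pronyIdeal f : Set (MvPolynomial (Fin s) ℂ)))
    (h0 : ∀ q, diffOp q u 0 = 0) : u = 0 :=
  eq_zero_of_mem_diffKer_of_intIndex hu fun α => by
    simpa [diffOp_monomial, shiftOp_apply] using h0 (MvPolynomial.monomial α 1)

theorem translateSpan_eq_diffKer_pronyIdeal :
    translateSpan f = diffKer (pronyIdeal f : Set (MvPolynomial (Fin s) ℂ)) := by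
  rw [translateSpan_eq_range]
  let K := diffKer (pronyIdeal f : Set (MvPolynomial (Fin s) ℂ))
  -- The pairing u ↦ (p ↦ (p(τ)u)(0)); its injectivity bounds dim K by dim Π/I.
  let Φ : K →ₗ[ℂ] Module.Dual ℂ
      (MvPolynomial (Fin s) ℂ ⧸ (pronyIdeal f).restrictScalars ℂ) :=
    { toFun := fun u => ((pronyIdeal f).restrictScalars ℂ).liftQ
        ((LinearMap.proj 0).comp (diffEval u.1)) fun p hp => by
          simp [diffEval_apply, mem_diffKer.1 u.2 p hp]
      map_add' := fun u v => by
        refine LinearMap.ext fun p => ?_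
        obtain ⟨p, rfl⟩ := Submodule.Quotient.mk_surjective _ p
        simp [diffEval_apply]
      map_smul' := fun c u => by
        refine LinearMap.ext fun p => ?_
        obtain ⟨p, rfl⟩ := Submodule.Quotient.mk_surjective _ p
        simp [diffEval_apply] }
  have hΦ : Function.Injective Φ := by
    refine (injective_iff_map_eq_zero Φ).2 fun u hu => Subtype.ext ?_
    refine eq_zero_of_mem_diffKer_of_diffOp u.2 fun q => ?_
    have := LinearMap.congr_fun hu (Submodule.Quotient.mk q)
    simpa [Φ, diffEval_apply] using this
  let e : (MvPolynomial (Fin s) ℂ ⧸ (pronyIdeal f).restrictScalars ℂ) ≃ₗ[ℂ] _ :=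
    (Submodule.Quotient.restrictScalarsEquiv ℂ (pronyIdeal f)).trans (quotientPronyEquiv f)
  have : FiniteDimensional ℂ (MvPolynomial (Fin s) ℂ ⧸ (pronyIdeal f).restrictScalars ℂ) :=
    Module.Finite.equiv e.symm
  have : FiniteDimensional ℂ K := Module.Finite.of_injective Φ hΦ
  refine Submodule.eq_of_le_of_finrank_le (fun g hg => mem_diffKer.2 fun p hp => ?_) ?_
  · obtain ⟨q, rfl⟩ := mem_range_diffEval.1 hg
    rw [← diffOp_mul, mul_comm, diffOp_mul, mem_pronyIdeal.1 hp, map_zero]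
  · exact (LinearMap.finrank_le_finrank_of_injective hΦ).trans
      (Subspace.dual_finrank_eq.trans e.finrank_eq).le

theorem isPronySystem_of_span_eq {Q : Finset (MvPolynomial (Fin s) ℂ)}
    (hQ : Ideal.span (Q : Set (MvPolynomial (Fin s) ℂ)) = pronyIdeal f) : IsPronySystem f Q := by
  refine ⟨?_, ?_⟩
  · rw [← diffKer_span, hQ, translateSpan_eq_diffKer_pronyIdeal]
  · rw [hQ]
    rfl

end FiniteDimensional

/-! ### Ideals of finite codimension: degree bounds -/

open MvPolynomial in
/-- If every variable satisfies a monic equation of degree `N` modulo `J`, then modulo `J` every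
polynomial has degree at most `N` in each variable. -/
theorem restrictDegree_sup_eq_top {s N : ℕ} (J : Ideal (MvPolynomial (Fin s) ℂ))
    (h : ∀ j, ∃ χ : Polynomial ℂ, χ.Monic ∧ χ.natDegree = N ∧
      Polynomial.aeval (X j : MvPolynomial (Fin s) ℂ) χ ∈ J) :
    restrictDegree (Fin s) ℂ N ⊔ J.restrictScalars ℂ = ⊤ := by
  set M := restrictDegree (Fin s) ℂ N ⊔ J.restrictScalars ℂ
  have key : ∀ (d : ℕ) (α : Fin s →₀ ℕ), α.degree = d → monomial α (1 : ℂ) ∈ M := by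
    intro d
    induction d using Nat.strong_induction_on with
    | _ d ih =>
      intro α hα
      by_cases hbox : ∀ j, α j ≤ N
      · exact Submodule.mem_sup_left ((monomial_mem_restrictSupport ℂ).2 (Or.inl hbox))
      push Not at hbox
      obtain ⟨j, hj⟩ := hbox
      obtain ⟨χ, hmonic, hdeg, hχ⟩ := h j
      -- Reducing the factor x_j^N of x^α by χ leaves only terms of smaller total degree.
      obtain ⟨β, rfl⟩ : ∃ β, β + Finsupp.single j N = α :=
        ⟨α - Finsupp.single j N, tsub_add_cancel_of_le (Finsupp.single_le_iff.2 hj.le)⟩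
      have hsum : monomial β (1 : ℂ) * Polynomial.aeval (X j : MvPolynomial (Fin s) ℂ) χ =
          monomial (β + Finsupp.single j N) 1 +
            ∑ i ∈ Finset.range N, χ.coeff i • monomial (β + Finsupp.single j i) (1 : ℂ) := by
        rw [Polynomial.aeval_eq_sum_range, hdeg, Finset.sum_range_succ, add_comm, mul_add,
          Finset.mul_sum, ← hdeg, hmonic.coeff_natDegree, hdeg]
        simp [X_pow_eq_monomial, monomial_mul, smul_monomial]
      rw [← sub_eq_iff_eq_add] at hsum
      rw [← hsum]
      refine Submodule.sub_mem _ (Submodule.mem_sup_right (J.mul_mem_left _ hχ))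
        (Submodule.sum_mem _ fun i hi => Submodule.smul_mem _ _ (ih _ ?_ _ rfl))
      rw [← hα]
      simpa using hi
  refine eq_top_iff.2 fun p _ => ?_
  induction p using MvPolynomial.induction_on' with
  | monomial α c =>
    have := Submodule.smul_mem M c (key _ α rfl)
    rwa [smul_monomial, smul_eq_mul, mul_one] at this
  | add p q hp hq => exact Submodule.add_mem _ (hp trivial) (hq trivial)

open MvPolynomial in
/-- An ideal of codimension at most `N` contains a monic polynomial of degree `N` in each
variable. -/
theorem exists_monic_aeval_X_mem {s N : ℕ} (I : Ideal (MvPolynomial (Fin s) ℂ))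
    [FiniteDimensional ℂ (MvPolynomial (Fin s) ℂ ⧸ I)]
    (hN : Module.finrank ℂ (MvPolynomial (Fin s) ℂ ⧸ I) ≤ N) (j : Fin s) :
    ∃ χ : Polynomial ℂ, χ.Monic ∧ χ.natDegree = N ∧
      Polynomial.aeval (X j : MvPolynomial (Fin s) ℂ) χ ∈ I := by
  let x : MvPolynomial (Fin s) ℂ ⧸ I := Ideal.Quotient.mkₐ ℂ I (X j)
  let φ := Algebra.lmul ℂ (MvPolynomial (Fin s) ℂ ⧸ I) x
  -- The characteristic polynomial has degree dim Π/I ≤ N; the power of `X` pads it to exactly N.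
  refine ⟨φ.charpoly * Polynomial.X ^ (N - φ.charpoly.natDegree),
    φ.charpoly_monic.mul (Polynomial.monic_X_pow _), ?_, ?_⟩
  · rw [φ.charpoly_monic.natDegree_mul (Polynomial.monic_X_pow _), Polynomial.natDegree_X_pow,
      Nat.add_sub_cancel' (φ.charpoly_natDegree.trans_le hN)]
  · rw [map_mul]
    refine I.mul_mem_right _ (Ideal.Quotient.eq_zero_iff_mem.1 ?_)
    change Ideal.Quotient.mkₐ ℂ I _ = 0
    rw [← Polynomial.aeval_algHom_apply]
    have h := φ.aeval_self_charpoly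
    rw [Polynomial.aeval_algHom_apply] at h
    have h1 := LinearMap.congr_fun h 1
    exact (mul_one _).symm.trans h1

open MvPolynomial in
theorem aeval_X_mem_restrictDegree {s N : ℕ} {χ : Polynomial ℂ} (hχ : χ.natDegree = N)
    (j : Fin s) : Polynomial.aeval (X j) χ ∈ restrictDegree (Fin s) ℂ N := by
  rw [Polynomial.aeval_eq_sum_range, hχ]
  refine Submodule.sum_mem _ fun i hi => Submodule.smul_mem _ _ ?_
  rw [X_pow_eq_monomial]
  refine (monomial_mem_restrictSupport ℂ).2 (Or.inl fun k => ?_)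
  rw [Finsupp.single_apply]
  have := Finset.mem_range.1 hi
  split_ifs <;> omega

open MvPolynomial in
/-- An ideal of codimension at most `N` is generated by its elements of degree at most `N` in each
variable. -/
theorem span_inf_restrictDegree_eq {s N : ℕ} (I : Ideal (MvPolynomial (Fin s) ℂ))
    [FiniteDimensional ℂ (MvPolynomial (Fin s) ℂ ⧸ I)]
    (hN : Module.finrank ℂ (MvPolynomial (Fin s) ℂ ⧸ I) ≤ N) :
    Ideal.span {p | p ∈ restrictDegree (Fin s) ℂ N ∧ p ∈ I} = I := by
  set J := Ideal.span {p | p ∈ restrictDegree (Fin s) ℂ N ∧ p ∈ I}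
  have hJI : J ≤ I := Ideal.span_le.2 fun p hp => hp.2
  refine le_antisymm hJI fun p hp => ?_
  -- The relations χ(x_j) already lie in J, so p = r + t with r of bounded degree and t ∈ J; then p
  -- ∈ I gives r ∈ I.
  have htop := restrictDegree_sup_eq_top (N := N) J fun j => by
    obtain ⟨χ, hm, hd, hI⟩ := exists_monic_aeval_X_mem I hN j
    exact ⟨χ, hm, hd, Ideal.subset_span ⟨aeval_X_mem_restrictDegree hd j, hI⟩⟩
  obtain ⟨r, hr, t, ht, rfl⟩ := Submodule.mem_sup.1 (htop.ge (Submodule.mem_top (x := p)))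
  have htJ : t ∈ J := ht
  exact J.add_mem (Ideal.subset_span ⟨hr, (I.add_mem_iff_left (hJI htJ)).1 hp⟩) htJ

open MvPolynomial in
/-- Membership in the Prony ideal is decided by finitely many values. -/
theorem mem_pronyIdeal_of_forall_box {s N : ℕ} {f : (Fin s → ℤ) → ℂ}
    [FiniteDimensional ℂ (LinearMap.range (diffEval f))]
    (hN : Module.finrank ℂ (LinearMap.range (diffEval f)) ≤ N) {p : MvPolynomial (Fin s) ℂ}
    (hp : ∀ β : Fin s →₀ ℕ, (∀ j, β j ≤ N) → diffOp p f (intIndex β) = 0) :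
    p ∈ pronyIdeal f := by
  have : FiniteDimensional ℂ (MvPolynomial (Fin s) ℂ ⧸ pronyIdeal f) :=
    Module.Finite.equiv (quotientPronyEquiv f).symm
  rw [← (quotientPronyEquiv f).finrank_eq] at hN
  have hker : diffOp p f ∈ diffKer (pronyIdeal f : Set (MvPolynomial (Fin s) ℂ)) :=
    mem_diffKer.2 fun q hq => by
      rw [← diffOp_mul, mul_comm, diffOp_mul, mem_pronyIdeal.1 hq, map_zero]
  refine mem_pronyIdeal.2 (eq_zero_of_mem_diffKer_of_diffOp hker fun q => ?_)
  -- Since q ∈ I annihilates p(τ)f, the values (q(τ)p(τ)f)(0) need testing only for monomials q in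
  -- the box.
  have htop := restrictDegree_sup_eq_top (pronyIdeal f) (exists_monic_aeval_X_mem _ hN)
  have hle : restrictDegree (Fin s) ℂ N ⊔ (pronyIdeal f).restrictScalars ℂ ≤
      LinearMap.ker ((LinearMap.proj 0).comp (diffEval (diffOp p f))) := by
    refine sup_le ?_ fun t ht => ?_
    · rw [restrictDegree, restrictSupport_eq_span, Submodule.span_le]
      rintro _ ⟨β, hβ, rfl⟩
      simp [diffEval_apply, diffOp_monomial, shiftOp_apply, hp β hβ]
    · simp [diffEval_apply, mem_diffKer.1 hker t ht]
  have := hle (htop.ge (Submodule.mem_top (x := q)))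
  simpa [diffEval_apply] using this

/-! ### Exponential polynomials: dimension bound by the total multiplicity -/

/-- Multiplication of a polynomial sequence by the exponential `α ↦ e^{ω^T α}`. -/
def mulExp {s : ℕ} (ω : Fin s → ℂ) : MvPolynomial (Fin s) ℂ →ₗ[ℂ] ((Fin s → ℤ) → ℂ) where
  toFun p α := MvPolynomial.eval (fun j => (α j : ℂ)) p * Complex.exp (∑ j, ω j * (α j : ℂ))
  map_add' p q := by
    ext α
    simp [add_mul]
  map_smul' c p := by
    ext α
    simp [MvPolynomial.smul_eval, mul_assoc]

theorem expPolySeq_eq_sum {s : ℕ} (Ω : Finset (Fin s → ℂ))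
    (c : (Fin s → ℂ) → MvPolynomial (Fin s) ℂ) :
    expPolySeq Ω c = ∑ ω ∈ Ω, mulExp ω (c ω) := by
  ext α
  simp [expPolySeq, mulExp]

theorem shiftOp_mulExp {s : ℕ} (ω : Fin s → ℂ) (p : MvPolynomial (Fin s) ℂ) (α : Fin s →₀ ℕ) :
    shiftOp (intIndex α) (mulExp ω p) =
      mulExp ω (Complex.exp (∑ j, ω j * (α j : ℂ)) • polyTranslate α p) := by
  ext x
  have : MvPolynomial.eval (fun j => (x j : ℂ)) (polyTranslate α p) =
      MvPolynomial.eval (fun j => (x j : ℂ) + (α j : ℂ)) p := by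
    rw [polyTranslate, MvPolynomial.eval, MvPolynomial.eval₂Hom_bind₁]
    simp
  simp only [shiftOp_apply, mulExp, LinearMap.coe_mk, AddHom.coe_mk, MvPolynomial.smul_eval, this,
    Pi.add_apply, intIndex, Int.cast_add, Int.cast_natCast, mul_add, Finset.sum_add_distrib,
    Complex.exp_add]
  ring

/-- The space `⊕ S(f_ω)` mapped to sequences. -/
def expPolyMap {s : ℕ} (Ω : Finset (Fin s → ℂ)) (c : (Fin s → ℂ) → MvPolynomial (Fin s) ℂ) :
    ((ω : Ω) → polyShiftSpan (c ω)) →ₗ[ℂ] ((Fin s → ℤ) → ℂ) :=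
  ∑ ω : Ω, ((mulExp ω.1).comp (polyShiftSpan (c ω)).subtype).comp (LinearMap.proj ω)

theorem range_diffEval_le_range_expPolyMap {s : ℕ} (Ω : Finset (Fin s → ℂ))
    (c : (Fin s → ℂ) → MvPolynomial (Fin s) ℂ) :
    LinearMap.range (diffEval (expPolySeq Ω c)) ≤ LinearMap.range (expPolyMap Ω c) := by
  intro g hg
  obtain ⟨q, rfl⟩ := mem_range_diffEval.1 hg
  rw [diffOp, LinearMap.sum_apply]
  refine Submodule.sum_mem _ fun α _ => Submodule.smul_mem _ _
    ⟨fun ω => ⟨Complex.exp (∑ j, ω.1 j * (α j : ℂ)) • polyTranslate α (c ω),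
      Submodule.smul_mem _ _ (Submodule.subset_span ⟨α, rfl⟩)⟩, ?_⟩
  rw [expPolySeq_eq_sum, map_sum, ← Finset.sum_coe_sort]
  simp only [expPolyMap, LinearMap.sum_apply, LinearMap.comp_apply, LinearMap.proj_apply,
    Submodule.subtype_apply]
  exact Finset.sum_congr rfl fun ω _ => (shiftOp_mulExp ω.1 (c ω) α).symm

theorem finiteDimensional_range_diffEval {s : ℕ} (Ω : Finset (Fin s → ℂ))
    (c : (Fin s → ℂ) → MvPolynomial (Fin s) ℂ) :
    FiniteDimensional ℂ (LinearMap.range (diffEval (expPolySeq Ω c))) := by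
  have := fun ω : Ω => polyShiftSpan_finite (c ω)
  exact Submodule.finiteDimensional_of_le (range_diffEval_le_range_expPolyMap Ω c)

theorem finrank_range_diffEval_le {s : ℕ} (Ω : Finset (Fin s → ℂ))
    (c : (Fin s → ℂ) → MvPolynomial (Fin s) ℂ) :
    Module.finrank ℂ (LinearMap.range (diffEval (expPolySeq Ω c))) ≤ totalMultiplicity Ω c := by
  have := fun ω : Ω => polyShiftSpan_finite (c ω)
  refine (Submodule.finrank_mono (range_diffEval_le_range_expPolyMap Ω c)).trans
    ((LinearMap.finrank_range_le _).trans ?_)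
  rw [Module.finrank_pi_fintype, totalMultiplicity, ← Finset.sum_coe_sort Ω]

/-! ### Division-free elimination as a decision tree -/

open MvPolynomial in
/-- Evaluation at `y` of the coefficients of an output polynomial. -/
def evalOutput {s : ℕ} {ι : Type} (y : ι → ℂ) :
    MvPolynomial (Fin s) (MvPolynomial ι ℤ) →+* MvPolynomial (Fin s) ℂ :=
  map (eval₂Hom (Int.castRingHom ℂ) y)

/-- The elements `x` of the span of a family of vectors with `h x = 0` are spanned by the
combinations of these vectors with a fixed one. -/
theorem mem_span_pivot_iff {V : Type*} [AddCommGroup V] [Module ℂ V] (S : Set V)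
    (h : V →ₗ[ℂ] ℂ) {v : V} (hv : v ∈ S) (hv0 : h v ≠ 0) (x : V) :
    x ∈ Submodule.span ℂ ((fun w => h v • w - h w • v) '' S) ↔
      x ∈ Submodule.span ℂ S ∧ h x = 0 := by
  -- Φ is h(v) times the projection onto ker h along v, and acts on ker h as the nonzero scalar
  -- h(v).
  let Φ : V →ₗ[ℂ] V := h v • LinearMap.id - h.smulRight v
  have hΦ : (fun w => h v • w - h w • v) = Φ := rfl
  rw [hΦ, ← Submodule.map_span, Submodule.mem_map]
  constructor
  · rintro ⟨w, hw, rfl⟩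
    refine ⟨?_, ?_⟩
    · exact Submodule.sub_mem _ (Submodule.smul_mem _ _ hw)
        (Submodule.smul_mem _ _ (Submodule.subset_span hv))
    · simp [Φ, mul_comm]
  · rintro ⟨hx, hx0⟩
    refine ⟨(h v)⁻¹ • x, Submodule.smul_mem _ _ hx, ?_⟩
    simp [Φ, hx0, hv0]

/-- A procedure that computes the common kernel of finitely many functionals, whose values are
integer polynomials in the input, on the span of finitely many computed polynomials. -/
theorem exists_algProc_span_run {s : ℕ} {ι : Type} {κ : Type*}
    (h : κ → MvPolynomial (Fin s) (MvPolynomial ι ℤ) →ₗ[MvPolynomial ι ℤ] MvPolynomial ι ℤ)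
    (hy : κ → (ι → ℂ) → MvPolynomial (Fin s) ℂ →ₗ[ℂ] ℂ)
    (hhy : ∀ k y p, hy k y (evalOutput y p) =
      MvPolynomial.eval₂Hom (Int.castRingHom ℂ) y (h k p)) (K : List κ) :
    ∀ L : List (MvPolynomial (Fin s) (MvPolynomial ι ℤ)), ∃ T : AlgProc s ι, ∀ y p,
      p ∈ Submodule.span ℂ (T.run y : Set (MvPolynomial (Fin s) ℂ)) ↔
        p ∈ Submodule.span ℂ (evalOutput y '' {q | q ∈ L}) ∧ ∀ k ∈ K, hy k y p = 0 := by
  classical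
  induction K with
  | nil =>
    refine fun L => ⟨.output L.toFinset, fun y p => ?_⟩
    simp [AlgProc.run, evalOutput]
  | cons k K ih =>
    intro L
    -- L' holds the pivot candidates not yet tested; the functional k vanishes on the rest of L.
    -- Once L' is empty, k imposes no condition on the span.
    suffices hsearch : ∀ L' : List (MvPolynomial (Fin s) (MvPolynomial ι ℤ)), L' ⊆ L →
        ∃ T : AlgProc s ι, ∀ y, (∀ q ∈ L, q ∉ L' → hy k y (evalOutput y q) = 0) → ∀ p,
          p ∈ Submodule.span ℂ (T.run y : Set (MvPolynomial (Fin s) ℂ)) ↔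
            p ∈ Submodule.span ℂ (evalOutput y '' {q | q ∈ L}) ∧ ∀ k' ∈ k :: K, hy k' y p = 0 by
      obtain ⟨T, hT⟩ := hsearch L (List.Subset.refl L)
      exact ⟨T, fun y => hT y fun q hq hq' => absurd hq hq'⟩
    intro L'
    induction L' with
    | nil =>
      obtain ⟨T, hT⟩ := ih L
      refine fun _ => ⟨T, fun y h0 p => ?_⟩
      rw [hT, List.forall_mem_cons]
      refine and_congr_right fun hp => ⟨fun hK => ⟨?_, hK⟩, fun hK => hK.2⟩
      have hle : Submodule.span ℂ (evalOutput y '' {q | q ∈ L}) ≤ LinearMap.ker (hy k y) := by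
        rw [Submodule.span_le]
        rintro _ ⟨q, hq, rfl⟩
        exact h0 q hq (by simp)
      exact hle hp
    | cons v L' ihL =>
      intro hL
      obtain ⟨hvL, hL'⟩ := List.cons_subset.1 hL
      obtain ⟨T₀, hT₀⟩ := ihL hL'
      obtain ⟨T₁, hT₁⟩ := ih (L.map fun w => h k v • w - h k w • v)
      -- `T₀` continues the search for a pivot; `T₁` handles the remaining functionals after
      -- elimination with the pivot v.
      refine ⟨.test (h k v) T₀ T₁, fun y h0 p => ?_⟩
      rw [AlgProc.run]
      split_ifs with hv
      · refine hT₀ y (fun q hq hq' => ?_) p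
        by_cases hqv : q = v
        · rw [hqv, hhy, hv]
        · exact h0 q hq (by simp [hqv, hq'])
      · rw [← hhy] at hv
        have himage : evalOutput y '' {q | q ∈ L.map fun w => h k v • w - h k w • v} =
            (fun w => hy k y (evalOutput y v) • w - hy k y w • evalOutput y v) ''
              (evalOutput y '' {q | q ∈ L}) := by
          have hset : {q | q ∈ L.map fun w => h k v • w - h k w • v} =
              (fun w => h k v • w - h k w • v) '' {q | q ∈ L} := by
            ext q
            simp
          rw [hset, Set.image_image, Set.image_image]
          refine Set.image_congr fun w _ => ?_
          simp only [hhy, map_sub, MvPolynomial.smul_eq_C_mul, map_mul]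
          simp [evalOutput]
        have hvS : evalOutput y v ∈ evalOutput y '' {q | q ∈ L} := ⟨v, hvL, rfl⟩
        rw [hT₁, himage, mem_span_pivot_iff _ (hy k y) hvS hv,
          List.forall_mem_cons, and_assoc]

/-! ### The Hankel matrix of samples -/

/-- The multi-indices with entries at most `N`. -/
def boxFinset (s N : ℕ) : Finset (Fin s →₀ ℕ) :=
  Finset.Iic (Finsupp.equivFunOnFinite.symm fun _ => N)

theorem mem_boxFinset {s N : ℕ} {β : Fin s →₀ ℕ} : β ∈ boxFinset s N ↔ ∀ j, β j ≤ N := by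
  rw [boxFinset, Finset.mem_Iic]
  rfl

/-- The sampling set, the multi-indices with entries between `0` and `2 N`. -/
def sampleFinset (s N : ℕ) : Finset (Fin s → ℤ) :=
  Fintype.piFinset fun _ => Finset.Icc 0 (2 * N : ℤ)

theorem intIndex_add_mem_sampleFinset {s N : ℕ} {α β : Fin s →₀ ℕ} (hα : ∀ j, α j ≤ N)
    (hβ : ∀ j, β j ≤ N) : intIndex α + intIndex β ∈ sampleFinset s N := by
  refine Fintype.mem_piFinset.2 fun j => Finset.mem_Icc.2 ?_
  have := hα j
  have := hβ j
  simp only [intIndex, Pi.add_apply]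
  omega

open MvPolynomial in
/-- The row with index `β` of the Hankel matrix of the samples, with symbolic entries. -/
def hankelRow (s N : ℕ) (β : Fin s →₀ ℕ) :
    MvPolynomial (Fin s) (MvPolynomial (sampleFinset s N) ℤ) →ₗ[MvPolynomial (sampleFinset s N) ℤ]
      MvPolynomial (sampleFinset s N) ℤ :=
  (basisMonomials (Fin s) _).constr ℤ fun α =>
    if h : intIndex α + intIndex β ∈ sampleFinset s N then X ⟨_, h⟩ else 0

open MvPolynomial in
/-- The row with index `β` of the Hankel matrix of the samples `y`. -/
def hankelRowEval (s N : ℕ) (β : Fin s →₀ ℕ) (y : sampleFinset s N → ℂ) :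
    MvPolynomial (Fin s) ℂ →ₗ[ℂ] ℂ :=
  (basisMonomials (Fin s) _).constr ℂ fun α =>
    if h : intIndex α + intIndex β ∈ sampleFinset s N then y ⟨_, h⟩ else 0

open MvPolynomial in
theorem hankelRow_monomial {s N : ℕ} (β α : Fin s →₀ ℕ)
    (c : MvPolynomial (sampleFinset s N) ℤ) : hankelRow s N β (monomial α c) =
      c * if h : intIndex α + intIndex β ∈ sampleFinset s N then X ⟨_, h⟩ else 0 := by
  have h := (basisMonomials (Fin s) (MvPolynomial (sampleFinset s N) ℤ)).constr_basis ℤ (fun α =>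
    if h : intIndex α + intIndex β ∈ sampleFinset s N then
      (X ⟨_, h⟩ : MvPolynomial (sampleFinset s N) ℤ) else 0) α
  rw [← mul_one c, ← smul_eq_mul c 1, ← smul_monomial, map_smul, smul_eq_mul, smul_eq_mul, mul_one,
    ← h, coe_basisMonomials]
  rfl

open MvPolynomial in
theorem hankelRowEval_monomial {s N : ℕ} (β α : Fin s →₀ ℕ) (y : sampleFinset s N → ℂ) (c : ℂ) :
    hankelRowEval s N β y (monomial α c) =
      c * if h : intIndex α + intIndex β ∈ sampleFinset s N then y ⟨_, h⟩ else 0 := by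
  have h := (basisMonomials (Fin s) ℂ).constr_basis ℂ (fun α =>
    if h : intIndex α + intIndex β ∈ sampleFinset s N then y ⟨_, h⟩ else 0) α
  rw [← mul_one c, ← smul_eq_mul c 1, ← smul_monomial, map_smul, smul_eq_mul, smul_eq_mul, mul_one,
    ← h, coe_basisMonomials]
  rfl

theorem hankelRowEval_evalOutput {s N : ℕ} (β : Fin s →₀ ℕ) (y : sampleFinset s N → ℂ)
    (p : MvPolynomial (Fin s) (MvPolynomial (sampleFinset s N) ℤ)) :
    hankelRowEval s N β y (evalOutput y p) =
      MvPolynomial.eval₂Hom (Int.castRingHom ℂ) y (hankelRow s N β p) := by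
  induction p using MvPolynomial.induction_on' with
  | monomial α c =>
    rw [evalOutput, MvPolynomial.map_monomial, hankelRowEval_monomial, hankelRow_monomial, map_mul]
    split_ifs <;> simp
  | add p q hp hq => simp only [map_add, hp, hq]

-- For α and β in the box the sample at α + β is available, so the default value 0 is never used.
open MvPolynomial in
theorem hankelRowEval_eq_diffOp {s N : ℕ} {β : Fin s →₀ ℕ} (hβ : ∀ j, β j ≤ N)
    (f : (Fin s → ℤ) → ℂ) {p : MvPolynomial (Fin s) ℂ} (hp : p ∈ restrictDegree (Fin s) ℂ N) :
    hankelRowEval s N β (fun α => f α) p = diffOp p f (intIndex β) := by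
  have hle : restrictDegree (Fin s) ℂ N ≤ LinearMap.eqLocus (hankelRowEval s N β fun α => f α)
      ((LinearMap.proj (intIndex β)).comp (diffEval f)) := by
    rw [restrictDegree, restrictSupport_eq_span, Submodule.span_le]
    rintro _ ⟨α, hα, rfl⟩
    rw [SetLike.mem_coe, LinearMap.mem_eqLocus, hankelRowEval_monomial,
      dif_pos (intIndex_add_mem_sampleFinset hα hβ)]
    simp [diffEval_apply, diffOp_monomial, shiftOp_apply, add_comm]
  have := LinearMap.mem_eqLocus.1 (hle hp)
  simpa [diffEval_apply] using this

open MvPolynomial in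
theorem span_evalOutput_box {s N : ℕ} {ι : Type} (y : ι → ℂ) :
    Submodule.span ℂ (evalOutput y '' {q | q ∈ (boxFinset s N).toList.map fun α =>
      (monomial α 1 : MvPolynomial (Fin s) (MvPolynomial ι ℤ))}) =
      restrictDegree (Fin s) ℂ N := by
  rw [restrictDegree, restrictSupport_eq_span]
  congr 1
  ext p
  simp [evalOutput, mem_boxFinset]

theorem exists_algProc_isPronySystem (s N : ℕ) : ∃ T : AlgProc s (sampleFinset s N),
    ∀ f : (Fin s → ℤ) → ℂ, FiniteDimensional ℂ (LinearMap.range (diffEval f)) →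
      Module.finrank ℂ (LinearMap.range (diffEval f)) ≤ N →
        IsPronySystem f (T.run fun α : sampleFinset s N => f α) := by
  obtain ⟨T, hT⟩ := exists_algProc_span_run (hankelRow s N) (hankelRowEval s N)
    hankelRowEval_evalOutput (boxFinset s N).toList
    ((boxFinset s N).toList.map fun α => MvPolynomial.monomial α 1)
  refine ⟨T, fun f hf hN => isPronySystem_of_span_eq ?_⟩
  specialize hT fun α => f α
  set Q := T.run fun α : sampleFinset s N => f α
  have : FiniteDimensional ℂ (MvPolynomial (Fin s) ℂ ⧸ pronyIdeal f) :=
    Module.Finite.equiv (quotientPronyEquiv f).symm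
  have hmem : ∀ p, p ∈ Submodule.span ℂ (Q : Set (MvPolynomial (Fin s) ℂ)) ↔
      p ∈ MvPolynomial.restrictDegree (Fin s) ℂ N ∧ p ∈ pronyIdeal f := fun p => by
    rw [hT, span_evalOutput_box]
    refine and_congr_right fun hp => ⟨fun h => mem_pronyIdeal_of_forall_box hN fun β hβ => ?_,
      fun h β hβ => ?_⟩
    · rw [← hankelRowEval_eq_diffOp hβ f hp]
      exact h β (Finset.mem_toList.2 (mem_boxFinset.2 hβ))
    · rw [hankelRowEval_eq_diffOp (mem_boxFinset.1 (Finset.mem_toList.1 hβ)) f hp,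
        mem_pronyIdeal.1 h, Pi.zero_apply]
  refine le_antisymm (Ideal.span_le.2 fun p hp => ((hmem p).1 (Submodule.subset_span hp)).2) ?_
  rw [← span_inf_restrictDegree_eq (pronyIdeal f) ((quotientPronyEquiv f).finrank_eq.trans_le hN),
    Ideal.span_le]
  intro p hp
  have hle : Submodule.span ℂ (Q : Set (MvPolynomial (Fin s) ℂ)) ≤
      (Ideal.span (Q : Set (MvPolynomial (Fin s) ℂ))).restrictScalars ℂ :=
    Submodule.span_le.2 Ideal.subset_span
  exact hle ((hmem p).2 hp)

end

theorem mainTheorem1 (s : ℕ) :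
    (∀ (Ω : Finset (Fin s → ℂ)) (c : (Fin s → ℂ) → MvPolynomial (Fin s) ℂ),
      ∃ Q : Finset (MvPolynomial (Fin s) ℂ), IsPronySystem (expPolySeq Ω c) Q) ∧
    (∀ N : ℕ, ∃ (Λ : Finset (Fin s → ℤ)) (T : AlgProc s Λ),
      ∀ (Ω : Finset (Fin s → ℂ)) (c : (Fin s → ℂ) → MvPolynomial (Fin s) ℂ),
        totalMultiplicity Ω c ≤ N →
          IsPronySystem (expPolySeq Ω c) (T.run (fun α : Λ => expPolySeq Ω c α))) := by
  have key : ∀ N : ℕ, ∃ (Λ : Finset (Fin s → ℤ)) (T : AlgProc s Λ),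
      ∀ (Ω : Finset (Fin s → ℂ)) (c : (Fin s → ℂ) → MvPolynomial (Fin s) ℂ),
        totalMultiplicity Ω c ≤ N →
          IsPronySystem (expPolySeq Ω c) (T.run (fun α : Λ => expPolySeq Ω c α)) := fun N => by
    obtain ⟨T, hT⟩ := exists_algProc_isPronySystem s N
    exact ⟨sampleFinset s N, T, fun Ω c hN => hT _ (finiteDimensional_range_diffEval Ω c)
      ((finrank_range_diffEval_le Ω c).trans hN)⟩
  refine ⟨fun Ω c => ?_, key⟩
  -- For a single sequence its own total multiplicity serves as the bound N.
  obtain ⟨Λ, T, hT⟩ := key (totalMultiplicity Ω c)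
  exact ⟨_, hT Ω c le_rfl⟩
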